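/- Let $(\mathcal N,\mathcal E)$ be a finite directed acyclic network with a source $s$ that has no incoming edge and a set of $L\ge 1$ destinations, different from $s$, that have no outgoing edge. In rounds $1,\dots,M$ ($M\ge 1$) the source multicasts frames $m^{(1)},\dots,m^{(M)}\in\mathbb F_q^B$, consecutive frames differing in at most $\epsilon$ symbols. In each round every node encodes, updates its cache and (if it is a destination) decodes as a function of its incoming data in that round (for the source: of the current frame only) and of its cache after the previous round; the source has no cache and all caches are empty initially. A scheme is achievable if every destination decodes every frame without error, for every such sequence of frames. Storing, respectively sending along $(i,j)\in\mathcal E$, $x$ bits for one round costs $f_i(x)$, respectively $f_{i,j}(x)$; a symbol of $\mathbb F_q$ counts $\log_2 q$ bits. The cost $\Psi_{\mathcal S}$ of a scheme $\mathcal S$ is the sum over all rounds of the costs of what is sent on each edge and, from round 2 on, of what the caching nodes hold in their caches. For $\Sigma=(\sigma_{i,j})_{(i,j)\in\mathcal E}$ in symbols and $\Delta=(\delta_i)_{i\ne s}$ put $\sigma_i=\sum_{\ell:(i,\ell)\in\mathcal E}\sigma_{i,\ell}$ if $i$ is not a destination, $\sigma_i=B$ if $i$ is a destination, and $$\Psi^*(\Sigma,\Delta)=\sum_{(i,j)\in\mathcal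 E}f_{i,j}(\sigma_{i,j}\log_2 q)+(M-1)\sum_{i\neq s}\Big((1-\delta_i)\sum_{j:(j,i)\in\mathcal E}f_{j,i}(\sigma_{j,i}\log_2 q)+\delta_i\Big(f_i(\sigma_i\log_2 q)+\sum_{j:(j,i)\in\mathcal E}f_{j,i}(2\epsilon\log_2 q)\Big)\Big).$$ Let $q$ be a prime power with $q\ge 2\epsilon B^{2\epsilon}$ and $q\ge L$. Consider the mixed-integer problem, in the variables $\widehat\Sigma=(\widehat\sigma_{i,j})$ (real, in bits) and $\widehat\Delta=(\widehat\delta_i)$, of minimizing the cost bound $\Psi^*$ (evaluated at link rates of $\widehat\sigma_{i,j}$ bits, that is at $\sigma_{i,j}=\widehat\sigma_{i,j}/\log_2 q$) subject to: $\widehat\delta_i\in\{0,1\}$ for $i\ne s$; and for each destination $t$ there is a virtual flow $\widehat\mu^{(t)}$ on the edges with $0\le\widehat\mu^{(t)}_{j,i}\le\widehat\sigma_{j,i}$ and $$\sum_{j:(i,j)\in\mathcal E}\widehat\mu^{(t)}_{i,j}-\sum_{j:(j,i)\in\mathcal E}\widehat\mu^{(t)}_{j,i}=\theta^{(t)}_i,$$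 where $\theta^{(t)}_s=B\log_2 q$ (a source rate of $B$ symbols), $\theta^{(t)}_t=-B\log_2 q$, and $\theta^{(t)}_i=0$ otherwise. Then for every feasible solution $(\widehat\Sigma,\widehat\Delta)$ there is an achievable scheme $\mathcal S$ over $\mathbb F_q$ in which node $i\ne s$ caches if and only if $\delta_i:=\widehat\delta_i=1$, what each node generates for its out-neighbours in every round is the output of one fixed linear network code that multicasts the frames to all destinations, every node sends linear encodings of what it generates, and 1. the number of symbols per round generated by node $i$ for node $j$ is $\sigma_{i,j}=\lceil\widehat\sigma_{i,j}/\log_2 q\rceil$ for every edge $(i,j)$; 2. the number of symbols sent by node $i$ to node $j$ is $\sigma_{i,j}$ in round 1 and $2\delta_j\epsilon+(1-\delta_j)\sigma_{i,j}$ in every later round; 3. the number of symbols cached by node $j\ne s$ after any round is at most $\delta_j\sigma_j$; 4. $\Psi_{\mathcal S}\le\Psi^*(\Sigma,\Delta)$ with $\Sigma=(\sigma_{i,j})$. -/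

import Mathlib

open Finset

namespace CacheMulticast

/-- A directed acyclic multicast network: a single source without incoming edges and a nonempty set
of destinations without outgoing edges (at most one edge from one node to another). -/
structure Network (V : Type*) where
  edges : Finset (V × V)
  source : V
  dests : Finset V
  dests_nonempty : dests.Nonempty
  source_notMem_dests : source ∉ dests
  acyclic : ∀ v, ¬ Relation.TransGen (fun a b => (a, b) ∈ edges) v v
  no_edge_into_source : ∀ v, (v, source) ∉ edges
  no_edge_out_of_dest : ∀ t ∈ dests, ∀ v, (t, v) ∉ edges

namespace Network

variable {V : Type*} [Fintype V] [DecidableEq V]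

/-- In-neighbours of a node. -/
def inN (G : Network V) (v : V) : Finset V := univ.filter fun u => (u, v) ∈ G.edges

/-- Out-neighbours of a node. -/
def outN (G : Network V) (v : V) : Finset V := univ.filter fun w => (v, w) ∈ G.edges

theorem wellFounded {V : Type*} [Finite V] (G : Network V) : WellFounded (fun u v : V => (u, v) ∈ G.edges) := by
  have h : WellFounded (Relation.TransGen (fun u v : V => (u, v) ∈ G.edges)) := by
    have : Std.Irrefl (Relation.TransGen (fun u v : V => (u, v) ∈ G.edges)) := ⟨G.acyclic⟩
    exact Finite.wellFounded_of_trans_of_irrefl _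
  exact Subrelation.wf (fun h => Relation.TransGen.single h) h

/-- What a node observes of the current frame `m`: the source sees `m`, all other nodes see
nothing (the constant `0`). -/
def observe (G : Network V) {F : Type*} [Zero F] {B : ℕ} (m : Fin B → F) (v : V) : Fin B → F :=
  if v = G.source then m else 0

end Network

section Code

variable {V : Type*} [Fintype V] [DecidableEq V] {F : Type*} [Field F]

/-- A (scalar) linear network code for frames in `F ^ B`, with `len v w` symbols on the edge
`v → w`. The outputs of a node are linear in its inputs; the input of the source is the frame, and
the output of a destination is its decoded frame. -/
structure LinearNetworkCode (G : Network V) (F : Type*) [Field F] (B : ℕ) (len : V → V → ℕ) where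
  frameCoeff : ∀ v w, Matrix (Fin (len v w)) (Fin B) F
  coeff : ∀ v u w, Matrix (Fin (len v w)) (Fin (len u v)) F
  decodeCoeff : ∀ t u, Matrix (Fin B) (Fin (len u t)) F

namespace LinearNetworkCode

variable {G : Network V} {B : ℕ} {len : V → V → ℕ}

/-- The vector that node `v` produces for node `w` when the frame is `m` (by recursion along the
acyclic network). -/
noncomputable def output (C : LinearNetworkCode G F B len) (m : Fin B → F) :
    ∀ v w, Fin (len v w) → F :=
  G.wellFounded.fix fun v y w =>
    (C.frameCoeff v w).mulVec (G.observe m v) +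
      ∑ u, if h : (u, v) ∈ G.edges then (C.coeff v u w).mulVec (y u h v) else 0

/-- Every destination obtains every frame. -/
def IsMulticast (C : LinearNetworkCode G F B len) : Prop :=
  ∀ m : Fin B → F, ∀ t ∈ G.dests,
    ∑ u ∈ G.inN t, (C.decodeCoeff t u).mulVec (C.output m u t) = m

end LinearNetworkCode

/-- A cache-aided scheme. Rounds are numbered `0, 1, 2, …`.
* `genLen v w`: number of symbols that `v` generates for `w` in each round;
* `sentLen r v w`: number of symbols that `v` sends to `w` in round `r`;
* `cacheLen r v`: number of symbols in the cache of `v` at the beginning of round `r`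
  (that is, after `r` completed rounds).
In each round a node sees its incoming data (the source: the current frame only) and its cache;
from these it generates one vector for each out-neighbour, updates its cache, and, if it is a
destination, decodes. What is sent on an edge is a linear encoding of the vector generated for it.
Only nodes in `caching` have a cache; the source has none; all caches are empty at the start. -/
structure Scheme (G : Network V) (F : Type*) [Field F] (B : ℕ) where
  genLen : V → V → ℕ
  sentLen : ℕ → V → V → ℕ
  cacheLen : ℕ → V → ℕ
  caching : Finset V
  source_notMem_caching : G.source ∉ caching
  cacheLen_zero : ∀ v, cacheLen 0 v = 0
  cacheLen_of_notMem : ∀ r, ∀ v ∉ caching, cacheLen r v = 0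
  generate : ∀ r v, (Fin B → F) → (∀ u, Fin (sentLen r u v) → F) → (Fin (cacheLen r v) → F) →
    ∀ w, Fin (genLen v w) → F
  send : ∀ r v w, (Fin (genLen v w) → F) →ₗ[F] (Fin (sentLen r v w) → F)
  update : ∀ r v, (Fin B → F) → (∀ u, Fin (sentLen r u v) → F) → (Fin (cacheLen r v) → F) →
    Fin (cacheLen (r + 1) v) → F
  decode : ∀ r t, (∀ u, Fin (sentLen r u t) → F) → (Fin (cacheLen r t) → F) → Fin B → F

namespace Scheme

variable {G : Network V} {B : ℕ}

/-- The vectors generated in round `r` when the frame is `m` and the cache contents are `c`. -/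
noncomputable def roundOutput (S : Scheme G F B) (r : ℕ) (m : Fin B → F)
    (c : ∀ v, Fin (S.cacheLen r v) → F) : ∀ v w, Fin (S.genLen v w) → F :=
  G.wellFounded.fix fun v y w =>
    S.generate r v (G.observe m v)
      (fun u => if h : (u, v) ∈ G.edges then S.send r u v (y u h v) else 0) (c v) w

/-- The data that node `v` receives from node `u` in round `r` (nothing, i.e. `0`, if there is no
edge `u → v`). -/
noncomputable def roundReceived (S : Scheme G F B) (r : ℕ) (m : Fin B → F)
    (c : ∀ v, Fin (S.cacheLen r v) → F) (v u : V) : Fin (S.sentLen r u v) → F :=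
  if (u, v) ∈ G.edges then S.send r u v (S.roundOutput r m c u v) else 0

/-- Cache contents at the beginning of round `r`, for the sequence of frames `m 0, m 1, …`. -/
noncomputable def cache (S : Scheme G F B) (m : ℕ → Fin B → F) :
    ∀ r v, Fin (S.cacheLen r v) → F
  | 0 => fun _ => 0
  | r + 1 => fun v => S.update r v (G.observe (m r) v)
      (S.roundReceived r (m r) (S.cache m r) v) (S.cache m r v)

/-- The vector generated by `v` for `w` in round `r`. -/
noncomputable def generated (S : Scheme G F B) (m : ℕ → Fin B → F) (r : ℕ) (v w : V) :
    Fin (S.genLen v w) → F :=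
  S.roundOutput r (m r) (S.cache m r) v w

/-- The frame decoded by `t` in round `r`. -/
noncomputable def decoded (S : Scheme G F B) (m : ℕ → Fin B → F) (r : ℕ) (t : V) : Fin B → F :=
  S.decode r t (S.roundReceived r (m r) (S.cache m r) t) (S.cache m r t)

end Scheme

/-- Sequences of `M` frames `m 0, …, m (M - 1)` in which consecutive frames differ in at most `ε`
symbols. -/
def Admissible [DecidableEq F] {B : ℕ} (M ε : ℕ) (m : ℕ → Fin B → F) : Prop :=
  ∀ r, r + 1 < M → hammingNorm (m (r + 1) - m r) ≤ ε

namespace Scheme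

variable {G : Network V} {B : ℕ}

/-- Zero-error decoding at all destinations, in all `M` rounds, for all admissible sequences. -/
def IsAchievable [DecidableEq F] (S : Scheme G F B) (M ε : ℕ) : Prop :=
  ∀ m : ℕ → Fin B → F, Admissible M ε m → ∀ r < M, ∀ t ∈ G.dests, S.decoded m r t = m r

/-- In every round, each node generates for its out-neighbours what the network code `C`
prescribes for the frame of that round. -/
def Implements [DecidableEq F] (S : Scheme G F B) (C : LinearNetworkCode G F B S.genLen)
    (M ε : ℕ) : Prop :=
  ∀ m : ℕ → Fin B → F, Admissible M ε m → ∀ r < M, ∀ v w, (v, w) ∈ G.edges →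
    S.generated m r v w = C.output (m r) v w

/-- The total cost of `M` rounds. The cost functions `linkCost` and `cacheCost` take numbers of
bits; a symbol of `F` counts `log₂ |F|` bits. In each round every edge is charged for what is sent
on it, and, from the second round on, every caching node for what its cache holds. -/
noncomputable def cost [Fintype F] (S : Scheme G F B) (M : ℕ)
    (linkCost : V → V → ℝ → ℝ) (cacheCost : V → ℝ → ℝ) : ℝ :=
  ∑ r ∈ range M,
    ((∑ e ∈ G.edges, linkCost e.1 e.2 (S.sentLen r e.1 e.2 * Real.logb 2 (Fintype.card F))) +
      if r = 0 then 0
      else ∑ v ∈ S.caching, cacheCost v (S.cacheLen r v * Real.logb 2 (Fintype.card F)))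

end Scheme

end Code

section Optimization

variable {V : Type*} [Fintype V] [DecidableEq V]

/-- Size of the output vector of a node, when `frame` is the size of a frame and `σ u v` is the size
of what is generated for the edge `u → v`: a destination outputs the decoded frame, and any other
node the vectors for its outgoing edges. -/
def outputSize {R : Type*} [AddCommMonoid R] (G : Network V) (frame : R) (σ : V → V → R) (v : V) :
    R :=
  if v ∈ G.dests then frame else ∑ w ∈ G.outN v, σ v w

/-- Bound on the cost of a round other than the first. All sizes are in bits: `frame` is the size
of a frame and `upd` the size of an update sent on a link into a caching node. -/
noncomputable def roundCostBound (G : Network V) (linkCost : V → V → ℝ → ℝ)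
    (cacheCost : V → ℝ → ℝ) (frame upd : ℝ) (σ : V → V → ℝ) (δ : V → ℝ) : ℝ :=
  ∑ i ∈ univ.erase G.source,
    ((1 - δ i) * ∑ j ∈ G.inN i, linkCost j i (σ j i) +
      δ i * (cacheCost i (outputSize G frame σ i) + ∑ j ∈ G.inN i, linkCost j i upd))

/-- The cost bound `Ψ*(Σ, Δ)` for `M` rounds, the objective of the optimization problem; all
sizes are in bits. -/
noncomputable def costBound (G : Network V) (linkCost : V → V → ℝ → ℝ)
    (cacheCost : V → ℝ → ℝ) (M : ℕ) (frame upd : ℝ) (σ : V → V → ℝ) (δ : V → ℝ) : ℝ :=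
  ∑ e ∈ G.edges, linkCost e.1 e.2 (σ e.1 e.2) +
    ((M : ℝ) - 1) * roundCostBound G linkCost cacheCost frame upd σ δ

/-- Feasibility of `(Σ, Δ)`: binary caching indicators, and for each destination `t` a nonnegative
virtual flow of value `rate` from the source to `t`, bounded on each edge by `σ`. -/
def Feasible (G : Network V) (rate : ℝ) (σ : V → V → ℝ) (δ : V → ℝ) : Prop :=
  (∀ v, v ≠ G.source → δ v = 0 ∨ δ v = 1) ∧
  ∃ μ : V → V → V → ℝ, ∀ t ∈ G.dests,
    (∀ j i, (j, i) ∈ G.edges → 0 ≤ μ t j i ∧ μ t j i ≤ σ j i) ∧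
    ∀ i, ∑ j ∈ G.outN i, μ t i j - ∑ j ∈ G.inN i, μ t j i =
      if i = G.source then rate else if i = t then -rate else 0

end Optimization

end CacheMulticast

open CacheMulticast

/-! Measured in symbols, each virtual flow has net outflows `B`, `-B` or `0`. Since these are
integers, the flow rounds to an integral one that stays below the rounded-up link rates
(`exists_integral_flow`, `Network.exists_isFlow`). Given integral flows, coding vectors are chosen
node by node so that for every destination the vectors on its current cut span the frame space. Each
choice avoids at most one proper subspace per destination, so a field with at least `L` elements
suffices (`exists_isMulticast`).

Caching is then added to this code (`exists_scheme`). The total output of a node is a linear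
function `R` of the frame. Two possible changes of the frame, each of weight at most `ε`, differ in
at most `2ε` positions, so the difference of their images under `R` lies in one of `B ^ (2ε)`
subspaces of dimension at most `2ε`. One linear map into `2ε` symbols is injective on all of them
(`exists_update_encoder`). Because `R` is a sum of linear contributions of the in-neighbours, each
of them can encode its own contribution without knowing the others. The caching node adds what it
receives, subtracts the encoding of its cached output, and recovers the change. The cost bound then
holds with equality, by regrouping edges by their heads. -/

namespace CacheMulticast

/-! ### Avoiding subspaces over a finite field, and the update encoder -/

section FiniteField

variable {F : Type*} [Field F] [Fintype F] {E : Type*} [AddCommGroup E] [Module F E]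
  [FiniteDimensional F E] {ι : Type*}

/-- A vector space over a field with `q` elements is not a union of `q` proper subspaces. -/
theorem exists_forall_notMem_of_card_le (s : Finset ι) (p : ι → Submodule F E)
    (hs : s.card ≤ Fintype.card F) (hp : ∀ i ∈ s, p i ≠ ⊤) : ∃ x, ∀ i ∈ s, x ∉ p i := by
  classical
  rcases s.eq_empty_or_nonempty with rfl | ⟨i₀, hi₀⟩
  · exact ⟨0, by simp⟩
  have : Finite E := Module.finite_of_finite F
  have := Fintype.ofFinite E
  by_contra! hcov
  set q := Fintype.card F with hqdef
  have hq : 1 < q := Fintype.one_lt_card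
  have hE : Fintype.card E = q ^ Module.finrank F E := Module.card_eq_pow_finrank
  have hpos : 0 < Module.finrank F E := by
    have := Submodule.finrank_lt (hp i₀ hi₀)
    omega
  obtain ⟨d, hd⟩ : ∃ d, Module.finrank F E = d + 1 := ⟨_, (Nat.succ_pred_eq_of_pos hpos).symm⟩
  -- Zero is left out because it lies in every subspace: `q * (q ^ d - 1) < q ^ (d + 1) - 1`,
  -- whereas counting all vectors would allow equality.
  have hcard : ∀ i ∈ s, (univ.filter fun x : E => x ∈ p i ∧ x ≠ 0).card ≤ q ^ d - 1 := by
    intro i hi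
    have h1 : (univ.filter fun x : E => x ∈ p i ∧ x ≠ 0)
        = (univ.filter fun x : E => x ∈ p i).erase 0 := by
      ext x; simp [and_comm]
    have h2 : (univ.filter fun x : E => x ∈ p i).card = q ^ Module.finrank F (p i) := by
      rw [← Fintype.card_subtype]
      exact Module.card_eq_pow_finrank (K := F) (V := p i)
    have h3 : Module.finrank F (p i) ≤ d := by
      have := Submodule.finrank_lt (hp i hi)
      omega
    rw [h1, card_erase_of_mem (by simp), h2]
    exact Nat.sub_le_sub_right (Nat.pow_le_pow_right hq.le h3) 1
  have hsub : (univ.erase (0 : E)) ⊆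
      s.biUnion fun i => univ.filter fun x : E => x ∈ p i ∧ x ≠ 0 := by
    intro x hx
    obtain ⟨i, hi, hxi⟩ := hcov x
    simp only [mem_biUnion, mem_filter, mem_univ, true_and]
    exact ⟨i, hi, hxi, by simpa using hx⟩
  have h4 := (card_le_card hsub).trans (card_biUnion_le_card_mul _ _ _ hcard)
  rw [card_erase_of_mem (mem_univ _), card_univ, hE, hd, pow_succ] at h4
  have h5 : s.card * (q ^ d - 1) ≤ q * (q ^ d - 1) := Nat.mul_le_mul_right _ hs
  have h6 : 1 ≤ q ^ d := Nat.one_le_pow _ _ (by omega)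
  obtain ⟨a, ha⟩ : ∃ a, q ^ d = a + 1 := ⟨q ^ d - 1, by omega⟩
  rw [ha] at h4 h5
  have h7 : (a + 1) * q = q * a + q := by ring
  simp only [Nat.add_sub_cancel] at h4 h5
  omega

theorem exists_mem_forall_notMem_of_card_le (W : Submodule F E) (s : Finset ι)
    (p : ι → Submodule F E) (hs : s.card ≤ Fintype.card F) (hp : ∀ i ∈ s, ¬ W ≤ p i) :
    ∃ x ∈ W, ∀ i ∈ s, x ∉ p i := by
  obtain ⟨x, hx⟩ := exists_forall_notMem_of_card_le s (fun i => (p i).comap W.subtype) hs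
    (fun i hi h => hp i hi (by simpa using h))
  exact ⟨x, x.2, fun i hi => hx i hi⟩

/-- Simultaneous completion of several subspaces to the whole space, by vectors of `W`. -/
theorem exists_forall_sup_span_image_eq_top {O : Type*} [DecidableEq O]
    (W : Submodule F E) (s : Finset ι) (hs : s.card ≤ Fintype.card F)
    (A : ι → Submodule F E) (o : Finset O) (P : ι → Finset O) (hPo : ∀ i ∈ s, P i ⊆ o)
    (hA : ∀ i ∈ s, A i ⊔ W = ⊤)
    (hcard : ∀ i ∈ s, Module.finrank F E ≤ Module.finrank F (A i) + (P i).card) :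
    ∃ g : O → E, (∀ x, g x ∈ W) ∧ ∀ i ∈ s, A i ⊔ Submodule.span F (g '' (P i)) = ⊤ := by
  classical
  induction o using Finset.induction_on generalizing A P with
  | empty =>
    refine ⟨0, fun _ => W.zero_mem, fun i hi => ?_⟩
    have h0 : P i = ∅ := subset_empty.mp (hPo i hi)
    have h1 := hcard i hi
    rw [h0, card_empty, add_zero] at h1
    rw [Submodule.eq_top_of_finrank_eq (le_antisymm (Submodule.finrank_le _) h1), top_sup_eq]
  | insert a o ha ih =>
    -- A proper `A i` cannot contain `W`, as the two together span. One `x` in `W` therefore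
    -- enlarges every proper `A i` whose `P i` contains `a`, which pays for the index removed.
    obtain ⟨x, hxW, hx⟩ := exists_mem_forall_notMem_of_card_le W
      (s.filter fun i => A i ≠ ⊤) A ((card_filter_le _ _).trans hs) (by
        intro i hi hle
        rw [mem_filter] at hi
        exact hi.2 (by rw [← hA i hi.1, sup_eq_left.mpr hle]))
    let A' : ι → Submodule F E := fun i => if a ∈ P i then A i ⊔ F ∙ x else A i
    have hAA' : ∀ i, A i ≤ A' i := by
      intro i; dsimp only [A']; split_ifs
      · exact le_sup_left
      · exact le_rfl
    obtain ⟨g, hgW, hg⟩ := ih A' (fun i => (P i).erase a)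
      (fun i hi => by
        intro y hy
        rw [mem_erase] at hy
        exact mem_of_mem_insert_of_ne (hPo i hi hy.2) hy.1)
      (fun i hi => top_le_iff.mp ((hA i hi).symm.le.trans (sup_le_sup_right (hAA' i) _)))
      (fun i hi => by
        by_cases haP : a ∈ P i
        · by_cases htop : A i = ⊤
          · have h2 : A' i = ⊤ := top_le_iff.mp (htop.symm.le.trans (hAA' i))
            rw [h2, finrank_top]
            exact Nat.le_add_right _ _
          · have hlt : A i < A' i := by
              simp only [A', haP, if_true]
              refine lt_of_le_of_ne le_sup_left fun h => hx i (mem_filter.mpr ⟨hi, htop⟩) ?_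
              rw [h]
              exact Submodule.mem_sup_right (Submodule.mem_span_singleton_self x)
            have h3 := Submodule.finrank_lt_finrank_of_lt hlt
            have h4 := hcard i hi
            have h5 := card_erase_add_one haP
            omega
        · have h6 : A' i = A i := by simp [A', haP]
          rw [h6, erase_eq_of_notMem haP]
          exact hcard i hi)
    refine ⟨Function.update g a x, fun y => ?_, fun i hi => ?_⟩
    · by_cases hy : y = a
      · subst hy; simpa using hxW
      · simpa [hy] using hgW y
    · have himg : Function.update g a x '' ((P i).erase a : Finset O) = g '' ((P i).erase a : Finset O) := by
        refine Set.image_congr fun y hy => ?_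
        have : y ≠ a := (mem_erase.mp hy).1
        simp [this]
      by_cases haP : a ∈ P i
      · have h7 := hg i hi
        simp only [A', haP, if_true] at h7
        rw [← insert_erase haP, coe_insert, Set.image_insert_eq, Submodule.span_insert,
          himg, Function.update_self, ← sup_assoc]
        exact h7
      · have h7 := hg i hi
        simp only [A', haP, if_false] at h7
        rw [← himg, erase_eq_of_notMem haP] at h7
        exact h7

/-- Few subspaces of dimension at most `k` embed simultaneously into a space of dimension `k`. -/
theorem exists_linearMap_forall_injOn (s : Finset ι) (hs : s.card ≤ Fintype.card F) (k : ℕ)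
    (W : ι → Submodule F E) (hW : ∀ i ∈ s, Module.finrank F (W i) ≤ k) :
    ∃ S : E →ₗ[F] (Fin k → F), ∀ i ∈ s, ∀ w ∈ W i, S w = 0 → w = 0 := by
  classical
  induction k generalizing W with
  | zero =>
    refine ⟨0, fun i hi w hw _ => ?_⟩
    have h := Submodule.finrank_eq_zero.mp (Nat.le_zero.mp (hW i hi))
    rw [h] at hw
    simpa using hw
  | succ k ih =>
    -- A functional that vanishes on no nonzero `W i` becomes the first coordinate. Its kernel meets
    -- each such `W i` in smaller dimension, and the other `k` coordinates treat these
    -- intersections.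
    obtain ⟨f, hf⟩ := exists_forall_notMem_of_card_le (E := Module.Dual F E)
      (s.filter fun i => W i ≠ ⊥) (fun i => (W i).dualAnnihilator)
      ((card_filter_le _ _).trans hs) (by
        intro i hi h
        rw [mem_filter] at hi
        exact hi.2 (by simpa using h))
    obtain ⟨S, hS⟩ := ih (fun i => W i ⊓ LinearMap.ker f) (by
      intro i hi
      by_cases hb : W i = ⊥
      · have h0 : W i ⊓ LinearMap.ker f = ⊥ := by rw [hb, bot_inf_eq]
        rw [h0, finrank_bot]
        exact Nat.zero_le k
      · have h1 := hf i (mem_filter.mpr ⟨hi, hb⟩)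
        have h2 : W i ⊓ LinearMap.ker f < W i := by
          refine lt_of_le_of_ne inf_le_left fun h => h1 ?_
          rw [Submodule.mem_dualAnnihilator]
          intro w hw
          rw [← h] at hw
          exact hw.2
        have h3 := Submodule.finrank_lt_finrank_of_lt h2
        have h4 := hW i hi
        omega)
    refine ⟨LinearMap.pi (Fin.cons f fun j => (LinearMap.proj j).comp S), fun i hi w hw h => ?_⟩
    have h0 : f w = 0 := by simpa using congrFun h 0
    refine hS i hi w ⟨hw, h0⟩ (funext fun j => ?_)
    simpa using congrFun h j.succ

/-- An encoding of `A x` into `2 ε` symbols that determines `A x` for all `x` with at most `ε`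
nonzero symbols. -/
theorem exists_update_encoder [DecidableEq F] {B ε : ℕ}
    (hq : 2 * ε * B ^ (2 * ε) ≤ Fintype.card F) (A : (Fin B → F) →ₗ[F] E) :
    ∃ S : E →ₗ[F] (Fin (2 * ε) → F), ∀ e e' : Fin B → F, hammingNorm e ≤ ε → hammingNorm e' ≤ ε →
      S (A e) = S (A e') → A e = A e' := by
  classical
  rcases Nat.eq_zero_or_pos ε with rfl | hε
  · refine ⟨0, fun e e' he he' _ => ?_⟩
    rw [Nat.le_zero, hammingNorm_eq_zero] at he he'
    rw [he, he']
  have hq' : (univ : Finset (Fin (2 * ε) → Fin B)).card ≤ Fintype.card F := by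
    simp only [card_univ, Fintype.card_fun, Fintype.card_fin]
    exact (Nat.le_mul_of_pos_left _ (by omega)).trans hq
  -- Supports are listed as tuples of `2 * ε` positions, repetitions allowed, so supports of every
  -- size up to `2 * ε` are covered by `B ^ (2 * ε)` subspaces.
  obtain ⟨S, hS⟩ := exists_linearMap_forall_injOn (E := E) univ hq' (2 * ε)
    (fun T => (Submodule.span F (Set.range fun j => (Pi.single (T j) 1 : Fin B → F))).map A)
    (fun T _ => (Submodule.finrank_map_le _ _).trans ((finrank_range_le_card _).trans (by simp)))
  refine ⟨S, fun e e' he he' h => ?_⟩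
  rw [← sub_eq_zero, ← map_sub, ← map_sub] at h
  rw [← sub_eq_zero, ← map_sub]
  set d := e - e' with hd
  by_cases hd0 : d = 0
  · simp [hd0]
  set D := univ.filter fun i => d i ≠ 0 with hD
  have hDcard : D.card ≤ 2 * ε := by
    have h1 : D ⊆ (univ.filter fun i => e i ≠ 0) ∪ (univ.filter fun i => e' i ≠ 0) := by
      intro i hi
      simp only [hD, mem_filter, mem_univ, true_and, mem_union, hd, Pi.sub_apply] at hi ⊢
      by_contra! hcon
      exact hi (by rw [hcon.1, hcon.2, sub_zero])
    have h2 := (card_le_card h1).trans (card_union_le _ _)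
    unfold hammingNorm at he he'
    omega
  have hDne : D.Nonempty := by
    by_contra hne
    rw [not_nonempty_iff_eq_empty] at hne
    refine hd0 (funext fun i => ?_)
    by_contra hi
    have : i ∈ D := by simpa [hD] using hi
    simp [hne] at this
  obtain ⟨T, hT⟩ : ∃ T : Fin (2 * ε) → Fin B, ∀ i ∈ D, ∃ j, T j = i := by
    obtain ⟨i₀, -⟩ := hDne
    refine ⟨fun j => if h : j.1 < D.card then (D.equivFin.symm ⟨j.1, h⟩).1 else i₀,
      fun i hi => ⟨⟨(D.equivFin ⟨i, hi⟩).1, (D.equivFin ⟨i, hi⟩).2.trans_le hDcard⟩, ?_⟩⟩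
    simp
  refine hS T (mem_univ _) (A d) (Submodule.mem_map_of_mem ?_) h
  rw [pi_eq_sum_univ' d]
  refine Submodule.sum_mem _ fun i _ => ?_
  by_cases hi : d i = 0
  · rw [hi, zero_smul]; exact Submodule.zero_mem _
  · obtain ⟨j, hj⟩ := hT i (by simpa [hD] using hi)
    refine Submodule.smul_mem _ _ (Submodule.subset_span ⟨j, ?_⟩)
    ext k
    simp [← hj, Pi.single_apply]

end FiniteField

/-! ### Integrality of flows -/

section Rounding

variable {V E : Type*} [DecidableEq V] [Fintype E]

/-- The net outflow at `v` of `x`, on a directed graph with edge set `E`. -/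
def netOut (src dst : E → V) (x : E → ℝ) (v : V) : ℝ :=
  ∑ e, ((if src e = v then x e else 0) - if dst e = v then x e else 0)

theorem netOut_add_smul (src dst : E → V) (x y : E → ℝ) (c : ℝ) (v : V) :
    netOut src dst (x + c • y) v = netOut src dst x v + c * netOut src dst y v := by
  simp only [netOut, mul_sum, ← sum_add_distrib, Pi.add_apply, Pi.smul_apply, smul_eq_mul]
  refine sum_congr rfl fun e _ => ?_
  split_ifs <;> ring

theorem sum_netOut [Fintype V] (src dst : E → V) (x : E → ℝ) : ∑ v, netOut src dst x v = 0 := by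
  simp only [netOut]
  rw [sum_comm]
  refine sum_eq_zero fun e _ => ?_
  simp [sum_sub_distrib]

/-- A nonzero circulation on the edges with a nonintegral flow. -/
theorem exists_circulation [Fintype V] (src dst : E → V) (hne : ∀ e, src e ≠ dst e) (x : E → ℝ)
    (hx : ∀ v, ∃ k : ℤ, netOut src dst x v = k) (hfrac : ∃ e, ∀ k : ℤ, x e ≠ k) :
    ∃ y : E → ℝ, y ≠ 0 ∧ (∀ v, netOut src dst y v = 0) ∧ ∀ e, (∃ k : ℤ, x e = k) → y e = 0 := by
  classical
  set D : Finset E := univ.filter fun e => ∀ k : ℤ, x e ≠ k with hD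
  set T : Finset V := univ.filter fun v => ∃ e ∈ D, src e = v ∨ dst e = v with hT
  -- Were `e₀` the only nonintegral edge at `v`, integrality of the net outflow would make `x e₀` an
  -- integer. Absence of loops ensures that `x e₀` does not cancel.
  have hdeg : ∀ v ∈ T, 2 ≤ (D.filter fun e => src e = v ∨ dst e = v).card := by
    intro v hv
    by_contra hlt
    obtain ⟨e₀, he₀, hv₀⟩ := (mem_filter.mp hv).2
    have hone : ∀ e, (src e = v ∨ dst e = v) → e ≠ e₀ → ∃ k : ℤ, x e = k := by
      intro e he hee
      by_contra! hk
      have h1 : 1 < (D.filter fun e => src e = v ∨ dst e = v).card :=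
        one_lt_card.mpr ⟨e, by simp [hD, he]; exact hk, e₀, by simp [he₀, hv₀], hee⟩
      omega
    obtain ⟨k, hk⟩ := hx v
    have hrest : ∃ k' : ℤ, ∑ e ∈ univ.erase e₀,
        ((if src e = v then x e else 0) - if dst e = v then x e else 0) = (k' : ℝ) := by
      have hall : ∀ e ∈ univ.erase e₀, ∃ k' : ℤ,
          ((if src e = v then x e else 0) - if dst e = v then x e else 0) = (k' : ℝ) := by
        intro e he
        by_cases h : src e = v ∨ dst e = v
        · obtain ⟨k', hk'⟩ := hone e h (ne_of_mem_erase he)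
          refine ⟨(if src e = v then k' else 0) - (if dst e = v then k' else 0), ?_⟩
          rw [hk']; push_cast; rfl
        · push Not at h
          exact ⟨0, by simp [h.1, h.2]⟩
      choose! κ hκ using hall
      exact ⟨∑ e ∈ univ.erase e₀, κ e, by push_cast; exact sum_congr rfl hκ⟩
    obtain ⟨k', hk'⟩ := hrest
    rw [netOut, ← add_sum_erase _ _ (mem_univ e₀), hk'] at hk
    have hfr : ∀ k : ℤ, x e₀ ≠ k := (mem_filter.mp he₀).2
    rcases hv₀ with h | h
    · have h' : dst e₀ ≠ v := fun h' => hne e₀ (h.trans h'.symm)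
      simp only [h, h', if_true, if_false] at hk
      exact hfr (k - k') (by push_cast; linarith)
    · have h' : src e₀ ≠ v := fun h' => hne e₀ (h'.trans h.symm)
      simp only [h, h', if_true, if_false] at hk
      exact hfr (k' - k) (by push_cast; linarith)
  have hcount : T.card ≤ D.card := by
    have h1 : 2 * T.card ≤ ∑ v ∈ T, (D.filter fun e => src e = v ∨ dst e = v).card := by
      rw [mul_comm, ← smul_eq_mul]
      exact card_nsmul_le_sum _ _ _ hdeg
    have h2 : ∑ v ∈ T, (D.filter fun e => src e = v ∨ dst e = v).card ≤ ∑ e ∈ D, 2 := by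
      simp only [card_filter]
      rw [sum_comm]
      refine sum_le_sum fun e _ => ?_
      rw [← card_filter]
      refine (card_le_card (t := {src e, dst e}) ?_).trans card_le_two
      intro v hv
      have := (mem_filter.mp hv).2
      simp only [mem_insert, mem_singleton]
      tauto
    rw [sum_const, smul_eq_mul] at h2
    omega
  obtain ⟨e₀, he₀⟩ := hfrac
  have he₀D : e₀ ∈ D := by simpa [hD] using he₀
  set v₀ := src e₀
  have hv₀T : v₀ ∈ T := by
    simp only [hT, mem_filter, mem_univ, true_and]
    exact ⟨e₀, he₀D, Or.inl rfl⟩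
  let ext : (D → ℝ) →ₗ[ℝ] (E → ℝ) :=
    { toFun := fun z e => if h : e ∈ D then z ⟨e, h⟩ else 0
      map_add' := fun z z' => by ext e; by_cases h : e ∈ D <;> simp [h]
      map_smul' := fun c z => by ext e; by_cases h : e ∈ D <;> simp [h] }
  let bd : (D → ℝ) →ₗ[ℝ] ({v // v ∈ T.erase v₀} → ℝ) :=
    { toFun := fun z v => netOut src dst (ext z) v
      map_add' := fun z z' => by
        ext v
        have := netOut_add_smul src dst (ext z) (ext z') 1 v
        simpa using this
      map_smul' := fun c z => by
        ext v
        have := netOut_add_smul src dst 0 (ext z) c v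
        have h0 : netOut src dst (0 : E → ℝ) v = 0 := by simp [netOut]
        simpa [h0] using this }
  -- There are `D.card` unknowns and only `T.card - 1` equations. The equation at `v₀` may be
  -- dropped, since net outflows sum to zero.
  have hker := LinearMap.ker_ne_bot_of_finrank_lt (f := bd) (by
    simp only [Module.finrank_fintype_fun_eq_card, Fintype.card_coe]
    rw [card_erase_of_mem hv₀T]
    have : 0 < T.card := card_pos.mpr ⟨_, hv₀T⟩
    omega)
  obtain ⟨z, hz, hz0⟩ := (Submodule.ne_bot_iff _).mp hker
  have hzero : ∀ v ≠ v₀, netOut src dst (ext z) v = 0 := by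
    intro v hv
    by_cases hvT : v ∈ T
    · exact congrFun (LinearMap.mem_ker.mp hz) ⟨v, mem_erase.mpr ⟨hv, hvT⟩⟩
    · refine sum_eq_zero fun e _ => ?_
      by_cases he : e ∈ D
      · have h1 : src e ≠ v := fun h => hvT (by simp only [hT, mem_filter, mem_univ, true_and]; exact ⟨e, he, Or.inl h⟩)
        have h2 : dst e ≠ v := fun h => hvT (by simp only [hT, mem_filter, mem_univ, true_and]; exact ⟨e, he, Or.inr h⟩)
        simp [h1, h2]
      · simp [ext, he]
  refine ⟨ext z, fun h => hz0 (funext fun e => ?_), fun v => ?_, fun e he => ?_⟩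
  · have := congrFun h e.1
    simpa [ext] using this
  · by_cases hv : v = v₀
    · have := sum_netOut src dst (ext z)
      rw [← add_sum_erase _ _ (mem_univ v₀), sum_eq_zero (s := univ.erase v₀)
        (fun w hw => hzero w (ne_of_mem_erase hw)), add_zero] at this
      rw [hv, this]
    · exact hzero v hv
  · have : e ∉ D := by
      obtain ⟨k, hk⟩ := he
      simp only [hD, mem_filter, mem_univ, true_and, not_forall, not_not]
      exact ⟨k, hk⟩
    simp [ext, this]

/-- Moving from `a` in direction `b ≠ 0`, one first meets an integer after some time `τ`, and stays
between `⌊a⌋` and `⌈a⌉` until then. -/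
theorem exists_time_to_integer (a b : ℝ) (hb : b ≠ 0) :
    ∃ τ : ℝ, 0 ≤ τ ∧ (∃ k : ℤ, a + τ * b = k) ∧
      ∀ c, 0 ≤ c → c ≤ τ → (⌊a⌋ : ℝ) ≤ a + c * b ∧ a + c * b ≤ ⌈a⌉ := by
  rcases lt_or_gt_of_ne hb with h | h
  · refine ⟨(⌊a⌋ - a) / b, div_nonneg_of_nonpos (by linarith [Int.floor_le a]) h.le, ⟨⌊a⌋, by field_simp; ring⟩,
      fun c hc hcτ => ⟨?_, ?_⟩⟩
    · rw [le_div_iff_of_neg h] at hcτ; linarith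
    · nlinarith [Int.le_ceil a]
  · refine ⟨(⌈a⌉ - a) / b, div_nonneg (by linarith [Int.le_ceil a]) h.le, ⟨⌈a⌉, by field_simp; ring⟩,
      fun c hc hcτ => ⟨?_, ?_⟩⟩
    · nlinarith [Int.floor_le a]
    · rw [le_div_iff₀ h] at hcτ; linarith

/-- A real flow with integral net outflows can be rounded to an integral flow. -/
theorem exists_integral_flow [Fintype V] (src dst : E → V) (hne : ∀ e, src e ≠ dst e) (x : E → ℝ)
    (hx : ∀ v, ∃ k : ℤ, netOut src dst x v = k) :
    ∃ f : E → ℤ, (∀ v, netOut src dst (fun e => (f e : ℝ)) v = netOut src dst x v) ∧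
      ∀ e, ⌊x e⌋ ≤ f e ∧ f e ≤ ⌈x e⌉ := by
  classical
  induction hn : (univ.filter fun e => ∀ k : ℤ, x e ≠ k).card using Nat.strong_induction_on
    generalizing x with
  | _ n ih =>
  by_cases hfrac : ∃ e, ∀ k : ℤ, x e ≠ k
  · obtain ⟨y, hy0, hyc, hyi⟩ := exists_circulation src dst hne x hx hfrac
    have htime : ∀ e, ∃ τ : ℝ, y e ≠ 0 → 0 ≤ τ ∧ (∃ k : ℤ, x e + τ * y e = k) ∧
        ∀ c, 0 ≤ c → c ≤ τ → (⌊x e⌋ : ℝ) ≤ x e + c * y e ∧ x e + c * y e ≤ ⌈x e⌉ := by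
      intro e
      by_cases h : y e = 0
      · exact ⟨0, fun h' => absurd h h'⟩
      · obtain ⟨τ, hτ⟩ := exists_time_to_integer (x e) (y e) h
        exact ⟨τ, fun _ => hτ⟩
    choose τ hτ using htime
    obtain ⟨e₁, he₁⟩ := Function.ne_iff.mp hy0
    -- Stopping at the earliest time makes `e₂` integral and keeps every other edge between its
    -- floor and ceiling. Integral edges do not move, so the number of nonintegral ones drops.
    obtain ⟨e₂, he₂, hmin⟩ := exists_min_image (univ.filter fun e => y e ≠ 0) τ
      ⟨e₁, by simpa using he₁⟩
    have hy₂ : y e₂ ≠ 0 := by simpa using he₂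
    obtain ⟨hc0, hint, -⟩ := hτ e₂ hy₂
    set c := τ e₂
    have hbd : ∀ e, (⌊x e⌋ : ℝ) ≤ (x + c • y) e ∧ (x + c • y) e ≤ ⌈x e⌉ := by
      intro e
      by_cases h : y e = 0
      · simp [h, Int.floor_le, Int.le_ceil]
      · exact (hτ e h).2.2 c hc0 (hmin e (by simpa using h))
    have hnet : ∀ v, netOut src dst (x + c • y) v = netOut src dst x v := by
      intro v; rw [netOut_add_smul, hyc, mul_zero, add_zero]
    obtain ⟨f, hf, hfb⟩ := ih _ (by
        rw [← hn]
        refine card_lt_card ((ssubset_iff_of_subset ?_).mpr ⟨e₂, ?_, ?_⟩)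
        · intro e he
          simp only [mem_filter, mem_univ, true_and] at he ⊢
          intro k hk
          refine he k ?_
          simp [hyi e ⟨k, hk⟩, hk]
        · simp only [mem_filter, mem_univ, true_and]
          intro k hk
          exact hy₂ (hyi e₂ ⟨k, hk⟩)
        · simp only [mem_filter, mem_univ, true_and, not_forall, not_not]
          simpa using hint)
      (x + c • y) (fun v => by rw [hnet]; exact hx v) rfl
    refine ⟨f, fun v => (hf v).trans (hnet v), fun e => ⟨?_, ?_⟩⟩
    · exact (Int.le_floor.mpr (hbd e).1).trans (hfb e).1
    · exact (hfb e).2.trans (Int.ceil_le.mpr (hbd e).2)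
  · push Not at hfrac
    choose f hf using hfrac
    refine ⟨f, fun v => by simp [netOut, hf], fun e => by simp [hf e]⟩

end Rounding

/-! ### Linear network codes from integral flows -/

section Coding

variable {V : Type*} [Fintype V] [DecidableEq V]

namespace Network

@[simp]
theorem mem_inN (G : Network V) {u v : V} : u ∈ G.inN v ↔ (u, v) ∈ G.edges := by simp [inN]

@[simp]
theorem mem_outN (G : Network V) {v w : V} : w ∈ G.outN v ↔ (v, w) ∈ G.edges := by simp [outN]

theorem ne_of_mem_edges {V : Type*} (G : Network V) {u v : V} (h : (u, v) ∈ G.edges) : u ≠ v := by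
  rintro rfl
  exact G.acyclic u (Relation.TransGen.single h)

theorem sum_outN_eq (G : Network V) {R : Type*} [AddCommMonoid R] (x : V → V → R) (v : V) :
    ∑ w ∈ G.outN v, x v w = ∑ e : G.edges, if e.1.1 = v then x e.1.1 e.1.2 else 0 := by
  rw [sum_coe_sort G.edges (fun e => if e.1 = v then x e.1 e.2 else 0), ← sum_filter]
  refine sum_bij' (fun w _ => (v, w)) (fun e _ => e.2) ?_ ?_ ?_ ?_ ?_ <;>
    simp +contextual [eq_comm]

theorem sum_inN_eq (G : Network V) {R : Type*} [AddCommMonoid R] (x : V → V → R) (v : V) :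
    ∑ u ∈ G.inN v, x u v = ∑ e : G.edges, if e.1.2 = v then x e.1.1 e.1.2 else 0 := by
  rw [sum_coe_sort G.edges (fun e => if e.2 = v then x e.1 e.2 else 0), ← sum_filter]
  refine sum_bij' (fun u _ => (u, v)) (fun e _ => e.1) ?_ ?_ ?_ ?_ ?_ <;>
    simp +contextual [eq_comm]

/-- A flow of `B` units from the source to `t`. -/
def IsFlow (G : Network V) (B : ℕ) (t : V) (f : V → V → ℕ) : Prop :=
  ∀ v, ∑ w ∈ G.outN v, f v w + (if v = t then B else 0) =
    ∑ u ∈ G.inN v, f u v + if v = G.source then B else 0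

/-- The capacities are integers, so rounding a flow value even up to its ceiling respects them. -/
theorem exists_isFlow (G : Network V) (B : ℕ) (len : V → V → ℕ) {t : V} (ht : t ∈ G.dests)
    (x : V → V → ℝ) (hx : ∀ j i, (j, i) ∈ G.edges → 0 ≤ x j i ∧ x j i ≤ len j i)
    (hflow : ∀ i, ∑ j ∈ G.outN i, x i j - ∑ j ∈ G.inN i, x j i =
      if i = G.source then (B : ℝ) else if i = t then -(B : ℝ) else 0) :
    ∃ f, G.IsFlow B t f ∧ ∀ j i, (j, i) ∈ G.edges → f j i ≤ len j i := by
  have hnet : ∀ y : V → V → ℝ, ∀ v, netOut (E := G.edges) (fun e => e.1.1) (fun e => e.1.2)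
      (fun e => y e.1.1 e.1.2) v = ∑ w ∈ G.outN v, y v w - ∑ u ∈ G.inN v, y u v := by
    intro y v
    rw [netOut, sum_sub_distrib, sum_outN_eq, sum_inN_eq]
  obtain ⟨f, hf, hfb⟩ := exists_integral_flow (E := G.edges) (fun e => e.1.1) (fun e => e.1.2)
    (fun e => G.ne_of_mem_edges e.2) (fun e => x e.1.1 e.1.2) (fun v => by
      rw [hnet, hflow]
      exact ⟨if v = G.source then B else if v = t then -B else 0, by push_cast; rfl⟩)
  have hf0 : ∀ e, 0 ≤ f e := fun e =>
    (Int.floor_nonneg.mpr (hx _ _ e.2).1).trans (hfb e).1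
  let f' : V → V → ℕ := fun u v => if h : (u, v) ∈ G.edges then (f ⟨(u, v), h⟩).toNat else 0
  have hf' : ∀ e : G.edges, (f' e.1.1 e.1.2 : ℝ) = f e := by
    intro e
    have h1 : (f e : ℝ) = (((f e).toNat : ℤ) : ℝ) := by rw [Int.toNat_of_nonneg (hf0 e)]
    rw [h1, Int.cast_natCast]
    simp only [f', e.2, dif_pos]
  refine ⟨f', fun v => ?_, fun j i h => ?_⟩
  · have h1 := hnet (fun u v => (f' u v : ℝ)) v
    simp only [hf'] at h1
    rw [hf, hnet, hflow] at h1
    have hst : G.source ≠ t := fun h => G.source_notMem_dests (h ▸ ht)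
    have h2 : ((∑ w ∈ G.outN v, f' v w + (if v = t then B else 0) : ℕ) : ℝ) =
        ((∑ u ∈ G.inN v, f' u v + if v = G.source then B else 0 : ℕ) : ℝ) := by
      push_cast
      by_cases hs : v = G.source
      · subst hs
        simp only [if_true, hst, if_false] at h1 ⊢
        linarith
      · by_cases hvt : v = t
        · subst hvt
          simp only [hs, if_true, if_false] at h1 ⊢
          linarith
        · simp only [hs, hvt, if_false] at h1 ⊢
          linarith
    exact_mod_cast h2
  · have h0 : ⌈x j i⌉ ≤ (len j i : ℤ) := Int.ceil_le.mpr (by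
      rw [Int.cast_natCast]; exact (hx j i h).2)
    have h1 := (hfb ⟨(j, i), h⟩).2.trans h0
    simp only [f', h, dif_pos]
    omega

end Network

variable {F : Type*} [Field F] {B : ℕ} {len : V → V → ℕ}

/-- The coding vectors on the edges into `v`. -/
def inVec (G : Network V) (g : ∀ v w, Fin (len v w) → Fin B → F) (v : V) :
    (Σ u, Fin (len u v)) → Fin B → F :=
  fun i => if (i.1, v) ∈ G.edges then g i.1 v i.2 else 0

/-- The coding vectors used by the flow `f` on the edges that leave `P`. -/
def crossing (G : Network V) (f : V → V → ℕ) (g : ∀ v w, Fin (len v w) → Fin B → F)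
    (P : Finset V) : Set (Fin B → F) :=
  {x | ∃ u ∈ P, ∃ w ∉ P, (u, w) ∈ G.edges ∧ ∃ k : Fin (len u w), k.1 < f u w ∧ g u w k = x}

/-- This is the completion lemma indexed by the outgoing symbols of `v`. The flow to `t` uses the
first `f t v w` symbols on each edge, and one choice of vectors must serve all destinations. -/
theorem exists_output_vectors [Fintype F] (G : Network V) (hL : G.dests.card ≤ Fintype.card F)
    (f : V → V → V → ℕ) (v : V)
    (hf : ∀ t ∈ G.dests, ∀ w, (v, w) ∈ G.edges → f t v w ≤ len v w)
    (W : Submodule F (Fin B → F)) (A : V → Submodule F (Fin B → F))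
    (hA : ∀ t ∈ G.dests, A t ⊔ W = ⊤)
    (hcard : ∀ t ∈ G.dests, B ≤ Module.finrank F (A t) + ∑ w ∈ G.outN v, f t v w) :
    ∃ h : ∀ w, Fin (len v w) → Fin B → F, (∀ w k, h w k ∈ W) ∧ ∀ t ∈ G.dests,
      A t ⊔ Submodule.span F {x | ∃ w, (v, w) ∈ G.edges ∧ ∃ k : Fin (len v w),
        k.1 < f t v w ∧ h w k = x} = ⊤ := by
  obtain ⟨h, hW, hh⟩ := exists_forall_sup_span_image_eq_top (O := Σ w, Fin (len v w)) W G.dests hL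
    A univ (fun t => (G.outN v).sigma fun w => univ.filter fun k => k.1 < f t v w)
    (fun _ _ => subset_univ _) hA (fun t ht => by
      rw [card_sigma, Module.finrank_fin_fun]
      refine (hcard t ht).trans (Nat.add_le_add_left (sum_le_sum fun w hw => ?_) _)
      rw [Fin.card_filter_val_lt]
      exact le_min (hf t ht w (by simpa using hw)) le_rfl)
  refine ⟨fun w k => h ⟨w, k⟩, fun w k => hW _, fun t ht => ?_⟩
  rw [← hh t ht]
  congr 2
  ext x
  simp only [Set.mem_ofPred_eq, Set.mem_image, mem_coe, mem_sigma, Network.mem_outN, mem_filter,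
    mem_univ, true_and, Sigma.exists]
  tauto

/-- A cut sweeps through the network: `P` is closed under predecessors, and for each destination the
flow vectors leaving `P` span. Adding a node whose predecessors all lie in `P` replaces its incoming
flow vectors by equally many outgoing places, to be filled from the span of its inputs. The number
`n` only counts the sweep. -/
theorem exists_coding_vectors_of_notMem_dests [Fintype F] (G : Network V)
    (hL : G.dests.card ≤ Fintype.card F) (f : V → V → V → ℕ)
    (hflow : ∀ t ∈ G.dests, G.IsFlow B t (f t))
    (hf : ∀ t ∈ G.dests, ∀ v w, (v, w) ∈ G.edges → f t v w ≤ len v w) (n : ℕ) :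
    ∃ P : Finset V, (n ≤ P.card ∨ P = univ \ G.dests) ∧ G.source ∈ P ∧ (∀ v ∈ P, v ∉ G.dests) ∧
      (∀ v ∈ P, ∀ u, (u, v) ∈ G.edges → u ∈ P) ∧
      ∃ g : ∀ v w, Fin (len v w) → Fin B → F,
        (∀ v ∈ P, v ≠ G.source → ∀ w k, g v w k ∈ Submodule.span F (Set.range (inVec G g v))) ∧
        ∀ t ∈ G.dests, Submodule.span F (crossing G (f t) g P) = ⊤ := by
  have hsd := G.source_notMem_dests
  have hstart : ∃ P : Finset V, G.source ∈ P ∧ (∀ v ∈ P, v ∉ G.dests) ∧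
      (∀ v ∈ P, ∀ u, (u, v) ∈ G.edges → u ∈ P) ∧
      ∃ g : ∀ v w, Fin (len v w) → Fin B → F,
        (∀ v ∈ P, v ≠ G.source → ∀ w k, g v w k ∈ Submodule.span F (Set.range (inVec G g v))) ∧
        ∀ t ∈ G.dests, Submodule.span F (crossing G (f t) g P) = ⊤ := by
    obtain ⟨h, -, hh⟩ := exists_output_vectors (len := len) (B := B) (F := F) G hL f G.source
      (fun t ht w => hf t ht _ w) ⊤ (fun _ => ⊥) (fun _ _ => sup_top_eq _) (fun t ht => by
        have h1 := hflow t ht G.source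
        have h2 : G.source ≠ t := fun h => hsd (h ▸ ht)
        simp only [h2, if_true, if_false] at h1
        omega)
    refine ⟨{G.source}, mem_singleton_self _, by simpa using hsd, ?_,
      Function.update 0 G.source h, ?_, fun t ht => ?_⟩
    · intro v hv u hu
      rw [mem_singleton.mp hv] at hu
      exact absurd hu (G.no_edge_into_source u)
    · intro v hv hvs
      exact absurd (mem_singleton.mp hv) hvs
    · rw [← hh t ht, bot_sup_eq]
      congr 1
      ext x
      simp only [crossing, mem_singleton, Set.mem_ofPred_eq, exists_eq_left, Function.update_self]
      constructor
      · rintro ⟨w, -, h1⟩; exact ⟨w, h1⟩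
      · rintro ⟨w, h1⟩
        exact ⟨w, (G.ne_of_mem_edges h1.1).symm, h1⟩
  induction n with
  | zero =>
    obtain ⟨P, hP⟩ := hstart
    exact ⟨P, Or.inl (Nat.zero_le _), hP⟩
  | succ n ih =>
    obtain ⟨P, hn, hsP, hPd, hPc, g, hg, hspan⟩ := ih
    by_cases hfull : P = univ \ G.dests
    · exact ⟨P, Or.inr hfull, hsP, hPd, hPc, g, hg, hspan⟩
    replace hn := hn.resolve_right hfull
    obtain ⟨v, ⟨hvd, hvP⟩, hmin⟩ := G.wellFounded.has_min {v | v ∉ G.dests ∧ v ∉ P} (by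
      by_contra hne
      rw [Set.not_nonempty_iff_eq_empty] at hne
      refine hfull (ext fun v => ?_)
      have : v ∉ {v | v ∉ G.dests ∧ v ∉ P} := by rw [hne]; simp
      simp only [Set.mem_ofPred_eq, not_and, not_not] at this
      simp only [mem_sdiff, mem_univ, true_and]
      exact ⟨hPd v, this⟩)
    have hvs : v ≠ G.source := fun h => hvP (h ▸ hsP)
    have hpred : ∀ u, (u, v) ∈ G.edges → u ∈ P := by
      intro u hu
      by_contra huP
      exact hmin u ⟨fun hud => G.no_edge_out_of_dest u hud v hu, huP⟩ hu
    have hsucc : ∀ w, (v, w) ∈ G.edges → w ∉ P := fun w hw hwP => hvP (hPc w hwP v hw)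
    let R : V → Set (Fin B → F) := fun t => {x | ∃ u ∈ P, ∃ w ∉ P, w ≠ v ∧ (u, w) ∈ G.edges ∧
      ∃ k : Fin (len u w), k.1 < f t u w ∧ g u w k = x}
    let I : ∀ t, Finset (Σ u, Fin (len u v)) := fun t =>
      (G.inN v).sigma fun u => univ.filter fun k => k.1 < f t u v
    have hRI : ∀ t ∈ G.dests, (⊤ : Submodule F (Fin B → F)) ≤
        Submodule.span F (R t) ⊔ Submodule.span F (inVec G g v '' (I t)) := by
      intro t ht
      rw [← hspan t ht, ← Submodule.span_union]
      refine Submodule.span_mono ?_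
      rintro x ⟨u, hu, w, hw, he, k, hk, rfl⟩
      by_cases hwv : w = v
      · subst hwv
        right
        exact ⟨⟨u, k⟩, by simpa [I, he] using hk, by simp [inVec, he]⟩
      · exact Or.inl ⟨u, hu, w, hw, hwv, he, k, hk, rfl⟩
    obtain ⟨h, hhW, hh⟩ := exists_output_vectors (len := len) (B := B) (F := F) G hL f v
      (fun t ht w => hf t ht _ w) (Submodule.span F (Set.range (inVec G g v)))
      (fun t => Submodule.span F (R t))
      (fun t ht => top_le_iff.mp ((hRI t ht).trans
        (sup_le_sup_left (Submodule.span_mono (Set.image_subset_range _ _)) _)))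
      (fun t ht => by
        have h1 := hflow t ht v
        have h2 : v ≠ t := fun h => hvd (h ▸ ht)
        simp only [h2, hvs, if_false] at h1
        -- Without the vectors entering `v`, the span loses at most as many dimensions as flow
        -- enters `v`, and by conservation the same amount leaves.
        have h3 := Submodule.finrank_add_le_finrank_add_finrank (Submodule.span F (R t))
          (Submodule.span F (inVec G g v '' (I t)))
        rw [top_le_iff.mp (hRI t ht), finrank_top, Module.finrank_fin_fun] at h3
        have h4 : Module.finrank F (Submodule.span F (inVec G g v '' (I t))) ≤ (I t).card := by
          classical
          rw [← coe_image]
          exact (finrank_span_finset_le_card _).trans card_image_le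
        have h5 : (I t).card ≤ ∑ u ∈ G.inN v, f t u v := by
          rw [card_sigma]
          refine sum_le_sum fun u _ => ?_
          rw [Fin.card_filter_val_lt]
          exact min_le_right _ _
        omega)
    have hupd : ∀ u ∈ P, Function.update g v h u = g u := fun u hu =>
      Function.update_of_ne (by rintro rfl; exact hvP hu) _ _
    have hin : ∀ u ∈ insert v P, inVec G (Function.update g v h) u = inVec G g u := by
      intro u hu
      funext ⟨w, k⟩
      simp only [inVec]
      by_cases he : (w, u) ∈ G.edges
      · have hw : w ∈ P := by
          rcases mem_insert.mp hu with rfl | hu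
          · exact hpred w he
          · exact hPc u hu w he
        simp [he, hupd w hw]
      · simp [he]
    refine ⟨insert v P, Or.inl (by rw [card_insert_of_notMem hvP]; omega),
      mem_insert_of_mem hsP, ?_, ?_, Function.update g v h, ?_, fun t ht => ?_⟩
    · intro u hu
      rcases mem_insert.mp hu with rfl | hu
      · exact hvd
      · exact hPd u hu
    · intro u hu w hw
      rcases mem_insert.mp hu with rfl | hu
      · exact mem_insert_of_mem (hpred w hw)
      · exact mem_insert_of_mem (hPc u hu w hw)
    · intro u hu hus w k
      rw [hin u hu]
      rcases mem_insert.mp hu with rfl | hu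
      · rw [Function.update_self]; exact hhW w k
      · rw [hupd u hu]; exact hg u hu hus w k
    · rw [← top_le_iff, ← hh t ht, ← Submodule.span_union]
      refine Submodule.span_mono ?_
      rintro x (⟨u, hu, w, hw, hwv, he, k, hk, rfl⟩ | ⟨w, he, k, hk, rfl⟩)
      · exact ⟨u, mem_insert_of_mem hu, w, by simp [hwv, hw], he, k, hk, by rw [hupd u hu]⟩
      · exact ⟨v, mem_insert_self _ _, w, by simp [hsucc w he, (G.ne_of_mem_edges he).symm],
          he, k, hk, by rw [Function.update_self]⟩

/-- Once the cut separates all destinations from the rest, the flow to `t` crosses it only into `t`: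
other destinations have no outgoing edges, so by conservation nothing flows into them. -/
theorem exists_coding_vectors [Fintype F] (G : Network V)
    (hL : G.dests.card ≤ Fintype.card F) (f : V → V → V → ℕ)
    (hflow : ∀ t ∈ G.dests, G.IsFlow B t (f t))
    (hf : ∀ t ∈ G.dests, ∀ v w, (v, w) ∈ G.edges → f t v w ≤ len v w) :
    ∃ g : ∀ v w, Fin (len v w) → Fin B → F,
      (∀ v ∉ G.dests, v ≠ G.source → ∀ w k,
        g v w k ∈ Submodule.span F (Set.range (inVec G g v))) ∧
      ∀ t ∈ G.dests, Submodule.span F (Set.range (inVec G g t)) = ⊤ := by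
  obtain ⟨P, hP, -, -, -, g, hg, hspan⟩ :=
    exists_coding_vectors_of_notMem_dests (F := F) G hL f hflow hf (Fintype.card V + 1)
  replace hP := hP.resolve_left (by have := card_le_univ P; omega)
  subst hP
  refine ⟨g, fun v hv => hg v (by simpa using hv), fun t ht => top_le_iff.mp ?_⟩
  rw [← hspan t ht]
  refine Submodule.span_mono ?_
  rintro x ⟨u, hu, w, hw, he, k, hk, rfl⟩
  have hwd : w ∈ G.dests := by simpa using hw
  have hwt : w = t := by
    by_contra hne
    have h1 := hflow t ht w
    have h2 : w ≠ G.source := fun h => G.source_notMem_dests (h ▸ hwd)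
    have h3 : G.outN w = ∅ := by
      ext z
      simpa using G.no_edge_out_of_dest w hwd z
    simp only [hne, h2, h3, if_false, sum_empty, add_zero] at h1
    have h4 := (sum_eq_zero_iff.mp h1.symm) u (by simpa using he)
    omega
  subst hwt
  exact ⟨⟨u, k⟩, by simp [inVec, he]⟩

namespace LinearNetworkCode

theorem output_eq {G : Network V} (C : LinearNetworkCode G F B len) (m : Fin B → F) (v w : V) :
    C.output m v w = (C.frameCoeff v w).mulVec (G.observe m v) +
      ∑ u ∈ G.inN v, (C.coeff v u w).mulVec (C.output m u v) := by
  unfold output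
  rw [WellFounded.fix_eq]
  congr 1
  rw [Network.inN, sum_filter]
  refine sum_congr rfl fun u _ => ?_
  split_ifs <;> rfl

end LinearNetworkCode

theorem sum_smul_inVec_dotProduct (G : Network V) (g : ∀ v w, Fin (len v w) → Fin B → F) (v : V)
    (c : (Σ u, Fin (len u v)) → F) (m : Fin B → F) :
    (∑ i, c i • inVec G g v i) ⬝ᵥ m = ∑ u ∈ G.inN v, ∑ k, c ⟨u, k⟩ * (g u v k ⬝ᵥ m) := by
  rw [sum_dotProduct, Fintype.sum_sigma, Network.inN, sum_filter]
  refine sum_congr rfl fun u _ => ?_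
  split_ifs with h
  · exact sum_congr rfl fun k _ => by simp [inVec, h, smul_dotProduct]
  · exact sum_eq_zero fun k _ => by simp [inVec, h]

/-- Network coding: the field size need only be the number of destinations. -/
theorem exists_isMulticast [Fintype F] (G : Network V)
    (hL : G.dests.card ≤ Fintype.card F) (f : V → V → V → ℕ)
    (hflow : ∀ t ∈ G.dests, G.IsFlow B t (f t))
    (hf : ∀ t ∈ G.dests, ∀ v w, (v, w) ∈ G.edges → f t v w ≤ len v w) :
    ∃ C : LinearNetworkCode G F B len, C.IsMulticast := by
  obtain ⟨g, hg, hspan⟩ := exists_coding_vectors (F := F) G hL f hflow hf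
  have hc : ∀ v w k, ∃ c : (Σ u, Fin (len u v)) → F, v ∉ G.dests → v ≠ G.source →
      ∑ i, c i • inVec G g v i = g v w k := by
    intro v w k
    by_cases h : v ∉ G.dests ∧ v ≠ G.source
    · obtain ⟨c, hc⟩ := (Submodule.mem_span_range_iff_exists_fun F).mp (hg v h.1 h.2 w k)
      exact ⟨c, fun _ _ => hc⟩
    · exact ⟨0, fun h1 h2 => absurd ⟨h1, h2⟩ h⟩
  choose c hc using hc
  have hd : ∀ t b, ∃ d : (Σ u, Fin (len u t)) → F, t ∈ G.dests →
      ∑ i, d i • inVec G g t i = Pi.single b 1 := by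
    intro t b
    by_cases h : t ∈ G.dests
    · obtain ⟨d, hd⟩ := (Submodule.mem_span_range_iff_exists_fun F).mp
        ((hspan t h).symm ▸ Submodule.mem_top : (Pi.single b 1 : Fin B → F) ∈ _)
      exact ⟨d, fun _ => hd⟩
    · exact ⟨0, fun h1 => absurd h1 h⟩
  choose d hd using hd
  -- `frameCoeff` matters at the source only, as every other node observes the zero frame.
  let C : LinearNetworkCode G F B len :=
    { frameCoeff := fun v w => Matrix.of (g v w)
      coeff := fun v u w => Matrix.of fun k k' => c v w k ⟨u, k'⟩
      decodeCoeff := fun t u => Matrix.of fun b k => d t b ⟨u, k⟩ }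
  have hout : ∀ m v w, (v, w) ∈ G.edges → ∀ k, C.output m v w k = g v w k ⬝ᵥ m := by
    intro m v
    induction v using G.wellFounded.induction with
    | _ v ih =>
    intro w he k
    rw [LinearNetworkCode.output_eq]
    by_cases hs : v = G.source
    · have h0 : G.inN v = ∅ := by
        ext u
        simpa [hs] using G.no_edge_into_source u
      rw [h0, sum_empty, add_zero, Network.observe, if_pos hs]
      rfl
    · rw [← hc v w k (fun hvd => G.no_edge_out_of_dest v hvd w he) hs, sum_smul_inVec_dotProduct]
      simp only [Network.observe, hs, if_false, Matrix.mulVec_zero, zero_add, Finset.sum_apply]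
      refine sum_congr rfl fun u hu => ?_
      rw [Network.mem_inN] at hu
      rw [funext (ih u hu v hu)]
      rfl
  refine ⟨C, fun m t ht => funext fun b => ?_⟩
  have h1 := congrArg (· ⬝ᵥ m) (hd t b ht)
  simp only [sum_smul_inVec_dotProduct, single_dotProduct, one_mul] at h1
  rw [← h1, Finset.sum_apply]
  refine sum_congr rfl fun u hu => ?_
  rw [Network.mem_inN] at hu
  rw [funext (hout m u t hu)]
  rfl

end Coding

/-! ### From a network code to a cache-aided scheme, and its cost -/

section SchemeConstruction

namespace Network

variable {V : Type*} [DecidableEq V] {F : Type*} [Field F] {B : ℕ}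

theorem observe_add (G : Network V) (m m' : Fin B → F) (v : V) :
    G.observe (m + m') v = G.observe m v + G.observe m' v := by
  unfold observe; split_ifs <;> simp

theorem observe_smul (G : Network V) (c : F) (m : Fin B → F) (v : V) :
    G.observe (c • m) v = c • G.observe m v := by
  unfold observe; split_ifs <;> simp

end Network

variable {V : Type*} [Fintype V] [DecidableEq V] {F : Type*} [Field F] {G : Network V} {B : ℕ}
  {len : V → V → ℕ}

/-- It spares explicit decoders: for a node to act as required, its observations need only determine
the required result on admissible sequences. -/
theorem exists_factor {α β γ : Type*} [Nonempty γ] (p : α → Prop) (i : α → β) (o : α → γ)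
    (h : ∀ a a', p a → p a' → i a = i a' → o a = o a') : ∃ f : β → γ, ∀ a, p a → f (i a) = o a := by
  classical
  refine ⟨fun b => if hb : ∃ a, p a ∧ i a = b then o hb.choose else Classical.arbitrary γ,
    fun a ha => ?_⟩
  have hb : ∃ a', p a' ∧ i a' = i a := ⟨a, ha, rfl⟩
  simp only [dif_pos hb]
  exact h _ _ hb.choose_spec.1 ha hb.choose_spec.2

namespace LinearNetworkCode

theorem output_eq_of_ne_source (C : LinearNetworkCode G F B len) (m : Fin B → F) {v : V}
    (hv : v ≠ G.source) (w : V) :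
    C.output m v w = ∑ u ∈ G.inN v, (C.coeff v u w).mulVec (C.output m u v) := by
  rw [output_eq, Network.observe, if_neg hv, Matrix.mulVec_zero, zero_add]

/-- The output of a node as a linear function of the frame. -/
noncomputable def outputLinear (C : LinearNetworkCode G F B len) (v w : V) :
    (Fin B → F) →ₗ[F] (Fin (len v w) → F) where
  toFun m := C.output m v w
  map_add' m m' := by
    induction v using G.wellFounded.induction generalizing w with
    | _ v ih =>
    rw [output_eq, output_eq C m, output_eq C m', Network.observe_add, Matrix.mulVec_add,
      sum_congr rfl fun u hu => by rw [ih u (G.mem_inN.mp hu), Matrix.mulVec_add],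
      sum_add_distrib]
    abel
  map_smul' c m := by
    induction v using G.wellFounded.induction generalizing w with
    | _ v ih =>
    rw [output_eq, output_eq C m, Network.observe_smul, Matrix.mulVec_smul,
      sum_congr rfl fun u hu => by rw [ih u (G.mem_inN.mp hu), RingHom.id_apply, Matrix.mulVec_smul],
      ← smul_sum, RingHom.id_apply, smul_add]

/-- All that a node outputs, as one vector that is a linear function of what it receives. -/
theorem exists_outputMap (C : LinearNetworkCode G F B len) (hC : C.IsMulticast) {v : V}
    (hv : v ≠ G.source) :
    ∃ (R : (Fin B → F) →ₗ[F] (Fin (outputSize G B len v) → F))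
      (K : ∀ u, (Fin (len u v) → F) →ₗ[F] (Fin (outputSize G B len v) → F)),
      (∀ m, R m = ∑ u ∈ G.inN v, K u (C.output m u v)) ∧
      (∀ m m', R m = R m' → ∀ w, (v, w) ∈ G.edges → C.output m v w = C.output m' v w) ∧
      (v ∈ G.dests → Function.Injective R) := by
  -- Any index type of the right size will do, so concatenated edge vectors can be indexed by a
  -- sigma type.
  suffices h : ∃ (J : Type) (_ : Fintype J), Fintype.card J = outputSize G B len v ∧
      ∃ (R : (Fin B → F) →ₗ[F] (J → F)) (K : ∀ u, (Fin (len u v) → F) →ₗ[F] (J → F)),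
      (∀ m, R m = ∑ u ∈ G.inN v, K u (C.output m u v)) ∧
      (∀ m m', R m = R m' → ∀ w, (v, w) ∈ G.edges → C.output m v w = C.output m' v w) ∧
      (v ∈ G.dests → Function.Injective R) by
    obtain ⟨J, _, hJ, R, K, hK, hout, hdec⟩ := h
    let e := LinearEquiv.funCongrLeft F F (Fintype.equivFinOfCardEq hJ).symm
    refine ⟨e.toLinearMap ∘ₗ R, fun u => e.toLinearMap ∘ₗ K u, fun m => ?_, fun m m' h => ?_,
      fun hd => e.injective.comp (hdec hd)⟩
    · simp [hK]
    · exact hout m m' (e.injective h)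
  by_cases hd : v ∈ G.dests
  · refine ⟨Fin B, inferInstance, by simp [outputSize, hd], LinearMap.id,
      fun u => (C.decodeCoeff v u).mulVecLin, fun m => ?_, fun m m' h => ?_,
      fun _ => Function.injective_id⟩
    · simpa using (hC m v hd).symm
    · rw [show m = m' from h]; simp
  · let J := Σ i : Fin (G.outN v).card, Fin (len v ((G.outN v).equivFin.symm i).1)
    have hsum : ∀ w (hw : w ∈ G.outN v), ((G.outN v).equivFin.symm ((G.outN v).equivFin ⟨w, hw⟩)).1
      = w := by simp
    refine ⟨J, inferInstance, ?_, LinearMap.pi fun j => LinearMap.proj j.2 ∘ₗ C.outputLinear v _,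
      fun u => LinearMap.pi fun j => LinearMap.proj j.2 ∘ₗ (C.coeff v u _).mulVecLin,
      fun m => ?_, fun m m' h => ?_, fun h => absurd h hd⟩
    · simp only [J, Fintype.card_sigma, Fintype.card_fin, outputSize, hd, if_false]
      rw [(G.outN v).equivFin.symm.sum_comp (fun w => len v w.1), sum_coe_sort _ (fun w => len v w)]
    · ext j
      have h1 := congrFun (C.output_eq_of_ne_source m hv ((G.outN v).equivFin.symm j.1).1) j.2
      simpa [outputLinear] using h1
    · intro w hw
      have key : ∀ i, C.output m v ((G.outN v).equivFin.symm i).1 =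
          C.output m' v ((G.outN v).equivFin.symm i).1 := fun i => funext fun k => by
        simpa [outputLinear] using congrFun h ⟨i, k⟩
      have h2 := key ((G.outN v).equivFin ⟨w, by simpa using hw⟩)
      rwa [hsum] at h2

end LinearNetworkCode

namespace Scheme

theorem roundOutput_eq (S : Scheme G F B) (r : ℕ) (m : Fin B → F)
    (c : ∀ v, Fin (S.cacheLen r v) → F) (v : V) :
    S.roundOutput r m c v =
      S.generate r v (G.observe m v) (S.roundReceived r m c v) (c v) := by
  funext w
  unfold roundOutput
  rw [WellFounded.fix_eq]
  congr 1

end Scheme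

/-- A caching node `v` stores `R v` of the latest frame. After the first round, its in-neighbour `u`
applies `enc v ∘ₗ K v u` to the vector generated for it; all other transmissions are uncoded. -/
theorem exists_scheme [Fintype F] [DecidableEq F] (C : LinearNetworkCode G F B len)
    (hC : C.IsMulticast) (D : Finset V) (hD : G.source ∉ D) (M ε : ℕ)
    (hq : 2 * ε * B ^ (2 * ε) ≤ Fintype.card F) :
    ∃ (S : Scheme G F B) (C' : LinearNetworkCode G F B S.genLen),
      C'.IsMulticast ∧ S.Implements C' M ε ∧ S.IsAchievable M ε ∧ S.caching = D ∧
      S.genLen = len ∧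
      (∀ r u v, S.sentLen r u v = if r = 0 ∨ v ∉ D then len u v else 2 * ε) ∧
      (∀ r v, S.cacheLen r v = if r = 0 ∨ v ∉ D then 0 else outputSize G B len v) := by
  have hR : ∀ v, ∃ (R : (Fin B → F) →ₗ[F] (Fin (outputSize G B len v) → F))
      (K : ∀ u, (Fin (len u v) → F) →ₗ[F] (Fin (outputSize G B len v) → F)),
      v ≠ G.source → (∀ m, R m = ∑ u ∈ G.inN v, K u (C.output m u v)) ∧
      (∀ m m', R m = R m' → ∀ w, (v, w) ∈ G.edges → C.output m v w = C.output m' v w) ∧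
      (v ∈ G.dests → Function.Injective R) := by
    intro v
    by_cases hv : v = G.source
    · exact ⟨0, 0, fun h => absurd hv h⟩
    · obtain ⟨R, K, h⟩ := C.exists_outputMap hC hv
      exact ⟨R, K, fun _ => h⟩
  choose R K hRK using hR
  choose enc henc using fun v => exists_update_encoder hq (R v)
  let sentLen : ℕ → V → V → ℕ := fun r u v => if r = 0 ∨ v ∉ D then len u v else 2 * ε
  let cacheLen : ℕ → V → ℕ := fun r v => if r = 0 ∨ v ∉ D then 0 else outputSize G B len v
  have hsend : ∀ r u v, ∃ φ : (Fin (len u v) → F) →ₗ[F] (Fin (sentLen r u v) → F),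
      (r = 0 ∨ v ∉ D → Function.Injective φ) ∧
      (¬ (r = 0 ∨ v ∉ D) → ∀ y y', φ y = φ y' → enc v (K v u y) = enc v (K v u y')) := by
    intro r u v
    by_cases h : r = 0 ∨ v ∉ D
    · have hs : sentLen r u v = len u v := if_pos h
      rw [hs]
      exact ⟨LinearMap.id, fun _ => Function.injective_id, fun h' => absurd h h'⟩
    · have hs : sentLen r u v = 2 * ε := if_neg h
      rw [hs]
      exact ⟨enc v ∘ₗ K v u, fun h' => absurd h' h, fun _ y y' hy => hy⟩
  choose send hsend_inj hsend_enc using hsend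
  -- Like `send`, `store` is kept only through its properties, which avoids casts between vector
  -- lengths given by case distinctions.
  have hstore : ∀ r v, ∃ κ : (Fin B → F) → (Fin (cacheLen r v) → F),
      (¬ (r = 0 ∨ v ∉ D) → ∀ m m', κ m = κ m' → R v m = R v m') ∧
      (∀ m m', R v m = R v m' → κ m = κ m') := by
    intro r v
    by_cases h : r = 0 ∨ v ∉ D
    · exact ⟨0, fun h' => absurd h h', fun _ _ _ => rfl⟩
    · have hs : cacheLen r v = outputSize G B len v := if_neg h
      rw [hs]
      exact ⟨R v, fun _ _ _ h => h, fun _ _ h => h⟩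
  choose store hstore_det hstore_fac using hstore
  let recv : ∀ r v, (ℕ → Fin B → F) → ∀ u, Fin (sentLen r u v) → F := fun r v m u =>
    if (u, v) ∈ G.edges then send r u v (C.output (m r) u v) else 0
  -- The core of the scheme: received data and cache determine the output. At `r = 0` the truncated
  -- index `r - 1` is harmless because the cache is empty.
  have hdet : ∀ r < M, ∀ v, v ≠ G.source → ∀ m m', Admissible M ε m → Admissible M ε m' →
      recv r v m = recv r v m' → store r v (m (r - 1)) = store r v (m' (r - 1)) →
      R v (m r) = R v (m' r) := by
    intro r hr v hv m m' hm hm' hrecv hstore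
    have hsent : ∀ u ∈ G.inN v,
        send r u v (C.output (m r) u v) = send r u v (C.output (m' r) u v) := by
      intro u hu
      have h1 := congrFun hrecv u
      simpa only [recv, G.mem_inN.mp hu, if_true] using h1
    by_cases h : r = 0 ∨ v ∉ D
    · rw [(hRK v hv).1, (hRK v hv).1]
      exact sum_congr rfl fun u hu => by rw [hsend_inj r u v h (hsent u hu)]
    · obtain ⟨p, rfl⟩ : ∃ p, r = p + 1 := ⟨r - 1, by omega⟩
      have hprev : R v (m p) = R v (m' p) := hstore_det _ v h _ _ hstore
      -- By linearity, the separately encoded contributions of the in-neighbours add up to the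
      -- encoding of the whole output.
      have hnew : enc v (R v (m (p + 1))) = enc v (R v (m' (p + 1))) := by
        rw [(hRK v hv).1, (hRK v hv).1, map_sum, map_sum]
        exact sum_congr rfl fun u hu => hsend_enc _ u v h _ _ (hsent u hu)
      have hdiff := henc v (m (p + 1) - m p) (m' (p + 1) - m' p) (hm p hr) (hm' p hr)
        (by rw [map_sub, map_sub, map_sub, map_sub, hnew, hprev])
      rw [map_sub, map_sub, hprev] at hdiff
      exact sub_left_injective hdiff
  have hobs : ∀ m m' : Fin B → F, G.observe m G.source = G.observe m' G.source → m = m' := by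
    intro m m' h
    simpa [Network.observe] using h
  have hgen : ∀ r v, ∃ f : (Fin B → F) × (∀ u, Fin (sentLen r u v) → F) × (Fin (cacheLen r v) → F) →
      ∀ w, Fin (len v w) → F, ∀ m, (r < M ∧ Admissible M ε m) →
      f (G.observe (m r) v, recv r v m, store r v (m (r - 1))) =
        fun w => if (v, w) ∈ G.edges then C.output (m r) v w else 0 := by
    intro r v
    refine exists_factor (fun m => r < M ∧ Admissible M ε m)
      (fun m => (G.observe (m r) v, recv r v m, store r v (m (r - 1)))) _ ?_
    rintro m m' ⟨hr, hm⟩ ⟨-, hm'⟩ h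
    simp only [Prod.mk.injEq] at h
    by_cases hv : v = G.source
    · subst hv
      rw [hobs _ _ h.1]
    · have h1 := (hRK v hv).2.1 _ _ (hdet r hr v hv m m' hm hm' h.2.1 h.2.2)
      funext w
      split_ifs with hw
      · rw [h1 w hw]
      · rfl
  choose gen hgen using hgen
  have hupd : ∀ r v, ∃ f : (Fin B → F) × (∀ u, Fin (sentLen r u v) → F) × (Fin (cacheLen r v) → F) →
      Fin (cacheLen (r + 1) v) → F, ∀ m, (r < M ∧ Admissible M ε m) →
      f (G.observe (m r) v, recv r v m, store r v (m (r - 1))) = store (r + 1) v (m r) := by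
    intro r v
    refine exists_factor (fun m => r < M ∧ Admissible M ε m)
      (fun m => (G.observe (m r) v, recv r v m, store r v (m (r - 1)))) _ ?_
    rintro m m' ⟨hr, hm⟩ ⟨-, hm'⟩ h
    simp only [Prod.mk.injEq] at h
    by_cases hv : v = G.source
    · subst hv
      rw [hobs _ _ h.1]
    · exact hstore_fac (r + 1) v _ _
        (hdet r hr v hv m m' hm hm' h.2.1 h.2.2)
  choose upd hupd using hupd
  have hdec : ∀ r v, ∃ f : (∀ u, Fin (sentLen r u v) → F) × (Fin (cacheLen r v) → F) →
      Fin B → F, ∀ m, (v ∈ G.dests ∧ r < M ∧ Admissible M ε m) →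
      f (recv r v m, store r v (m (r - 1))) = m r := by
    intro r v
    refine exists_factor (fun m => v ∈ G.dests ∧ r < M ∧ Admissible M ε m)
      (fun m => (recv r v m, store r v (m (r - 1)))) _ ?_
    rintro m m' ⟨hd, hr, hm⟩ ⟨-, -, hm'⟩ h
    simp only [Prod.mk.injEq] at h
    have hv : v ≠ G.source := fun h => G.source_notMem_dests (h ▸ hd)
    exact (hRK v hv).2.2 hd (hdet r hr v hv m m' hm hm' h.1 h.2)
  choose dec hdec using hdec
  have hsub : ∀ v, Subsingleton (Fin (cacheLen 0 v) → F) := by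
    intro v
    have h0 : cacheLen 0 v = 0 := by simp [cacheLen]
    rw [h0]
    infer_instance
  let S : Scheme G F B :=
    { genLen := len
      sentLen := sentLen
      cacheLen := cacheLen
      caching := D
      source_notMem_caching := hD
      cacheLen_zero := fun v => by simp [cacheLen]
      cacheLen_of_notMem := fun r v hv => by simp [cacheLen, hv]
      generate := fun r v m y c => gen r v (m, y, c)
      send := send
      update := fun r v m y c => upd r v (m, y, c)
      decode := fun r v y c => dec r v (y, c) }
  -- Correctness within a round, by induction along the network, presupposes the intended caches;
  -- `hcache` then supplies them by induction on rounds.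
  have hround : ∀ m, Admissible M ε m → ∀ r < M, ∀ v,
      (S.roundReceived r (m r) (fun v => store r v (m (r - 1))) v = recv r v m) ∧
      ∀ w, (v, w) ∈ G.edges →
        S.roundOutput r (m r) (fun v => store r v (m (r - 1))) v w = C.output (m r) v w := by
    intro m hm r hr v
    induction v using G.wellFounded.induction with
    | _ v ih =>
    have hrecv : S.roundReceived r (m r) (fun v => store r v (m (r - 1))) v = recv r v m := by
      funext u
      simp only [Scheme.roundReceived, recv]
      split_ifs with hu
      · rw [(ih u hu).2 v hu]
      · rfl
    refine ⟨hrecv, fun w hw => ?_⟩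
    rw [Scheme.roundOutput_eq, hrecv]
    have h1 := congrFun (hgen r v m ⟨hr, hm⟩) w
    simpa only [hw, if_true] using h1
  have hcache : ∀ m, Admissible M ε m → ∀ r < M,
      S.cache m r = fun v => store r v (m (r - 1)) := by
    intro m hm r
    induction r with
    | zero => exact fun _ => funext fun v => (hsub v).elim _ _
    | succ r ih =>
      intro hr
      funext v
      rw [Scheme.cache, ih (by omega)]
      dsimp only
      rw [(hround m hm r (by omega) v).1]
      exact hupd r v m ⟨by omega, hm⟩
  refine ⟨S, C, hC, ?_, ?_, rfl, rfl, fun _ _ _ => rfl, fun _ _ => rfl⟩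
  · intro m hm r hr v w hw
    rw [Scheme.generated, hcache m hm r hr]
    exact (hround m hm r hr v).2 w hw
  · intro m hm r hr t ht
    rw [Scheme.decoded, hcache m hm r hr, (hround m hm r hr t).1]
    exact hdec r t m ⟨ht, hr, hm⟩

/-- The costs in a round are the summands of `roundCostBound`, if the indicators are binary. -/
theorem roundCost_eq_roundCostBound (linkCost : V → V → ℝ → ℝ) (cacheCost : V → ℝ → ℝ)
    (frame upd : ℝ) (σ : V → V → ℝ) (δ : V → ℝ) (D : Finset V) (hsD : G.source ∉ D)
    (h1 : ∀ v ∈ D, δ v = 1) (h0 : ∀ v, v ≠ G.source → v ∉ D → δ v = 0) :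
    ∑ e ∈ G.edges, linkCost e.1 e.2 (if e.2 ∈ D then upd else σ e.1 e.2) +
      ∑ v ∈ D, cacheCost v (outputSize G frame σ v) =
    roundCostBound G linkCost cacheCost frame upd σ δ := by
  have hlink : ∑ e ∈ G.edges, linkCost e.1 e.2 (if e.2 ∈ D then upd else σ e.1 e.2) =
      ∑ i ∈ univ.erase G.source,
        ∑ j ∈ G.inN i, linkCost j i (if i ∈ D then upd else σ j i) := by
    have hs : ∑ j ∈ G.inN G.source,
        linkCost j G.source (if G.source ∈ D then upd else σ j G.source) = 0 := by
      refine sum_eq_zero fun j hj => ?_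
      exact absurd (G.mem_inN.mp hj) (G.no_edge_into_source j)
    rw [sum_erase (f := fun i => ∑ j ∈ G.inN i, linkCost j i (if i ∈ D then upd else σ j i)) _ hs,
      sum_congr rfl fun i _ =>
        G.sum_inN_eq (fun j i => linkCost j i (if i ∈ D then upd else σ j i)) i, sum_comm]
    simp only [sum_ite_eq, mem_univ, if_true]
    rw [sum_coe_sort G.edges fun e => linkCost e.1 e.2 (if e.2 ∈ D then upd else σ e.1 e.2)]
  have hcache : ∑ v ∈ D, cacheCost v (outputSize G frame σ v) =
      ∑ v ∈ univ.erase G.source, if v ∈ D then cacheCost v (outputSize G frame σ v) else 0 := by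
    rw [← sum_filter]
    refine sum_congr (ext fun v => ?_) fun _ _ => rfl
    simp only [mem_filter, mem_erase, mem_univ, and_true]
    exact ⟨fun hv => ⟨fun h => hsD (h ▸ hv), hv⟩, fun h => h.2⟩
  rw [hlink, hcache, ← sum_add_distrib, roundCostBound]
  refine sum_congr rfl fun i hi => ?_
  by_cases hiD : i ∈ D
  · simp only [h1 i hiD, hiD, if_true]; ring
  · simp only [h0 i (ne_of_mem_erase hi) hiD, hiD, if_false]; ring

end SchemeConstruction

end CacheMulticast

/-! ### From feasible solutions to schemes -/

theorem theorem1 {V : Type*} [Fintype V] [DecidableEq V] (G : Network V)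
    (linkCost : V → V → ℝ → ℝ) (cacheCost : V → ℝ → ℝ) (B ε M : ℕ) (hM : 1 ≤ M)
    {F : Type*} [Field F] [Fintype F] [DecidableEq F]
    (hq : 2 * ε * B ^ (2 * ε) ≤ Fintype.card F) (hL : G.dests.card ≤ Fintype.card F)
    (σhat : V → V → ℝ) (δhat : V → ℝ)
    (hfeas : Feasible G (B * Real.logb 2 (Fintype.card F)) σhat δhat) :
    ∃ (S : Scheme G F B) (C : LinearNetworkCode G F B S.genLen),
      C.IsMulticast ∧ S.Implements C M ε ∧ S.IsAchievable M ε ∧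
      -- which nodes cache
      (∀ v, v ≠ G.source → (v ∈ S.caching ↔ δhat v = 1)) ∧
      -- symbols generated per round
      (∀ i j, (i, j) ∈ G.edges →
        S.genLen i j = ⌈σhat i j / Real.logb 2 (Fintype.card F)⌉₊) ∧
      -- symbols sent in the first round and in every later round
      (∀ i j, (i, j) ∈ G.edges → S.sentLen 0 i j = S.genLen i j) ∧
      (∀ r, 1 ≤ r → r < M → ∀ i j, (i, j) ∈ G.edges →
        (S.sentLen r i j : ℝ) = 2 * δhat j * ε + (1 - δhat j) * S.genLen i j) ∧
      -- symbols cached after each round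
      (∀ r ≤ M, ∀ j, j ≠ G.source →
        (S.cacheLen r j : ℝ) ≤ δhat j * outputSize G B S.genLen j) ∧
      -- total cost
      S.cost M linkCost cacheCost ≤
        costBound G linkCost cacheCost M (B * Real.logb 2 (Fintype.card F))
          (2 * ε * Real.logb 2 (Fintype.card F))
          (fun i j => S.genLen i j * Real.logb 2 (Fintype.card F)) δhat := by
  classical
  obtain ⟨hδ, μ, hμ⟩ := hfeas
  set ℓ := Real.logb 2 (Fintype.card F) with hℓ
  have hℓpos : 0 < ℓ := Real.logb_pos one_lt_two (by exact_mod_cast Fintype.one_lt_card)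
  set len : V → V → ℕ := fun i j => ⌈σhat i j / ℓ⌉₊ with hlen
  have hflow : ∀ t, ∃ f, t ∈ G.dests →
      G.IsFlow B t f ∧ ∀ j i, (j, i) ∈ G.edges → f j i ≤ len j i := by
    intro t
    by_cases ht : t ∈ G.dests
    · obtain ⟨hcap, hcons⟩ := hμ t ht
      obtain ⟨f, hf⟩ := G.exists_isFlow B len ht (fun j i => μ t j i / ℓ)
        (fun j i h => ⟨div_nonneg (hcap j i h).1 hℓpos.le,
          (div_le_div_of_nonneg_right (hcap j i h).2 hℓpos.le).trans (Nat.le_ceil _)⟩)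
        (fun i => by
          rw [← sum_div, ← sum_div, ← sub_div, hcons i]
          split_ifs <;> simp [neg_div, hℓpos.ne'])
      exact ⟨f, fun _ => hf⟩
    · exact ⟨0, fun h => absurd h ht⟩
  choose f hf using hflow
  obtain ⟨C, hC⟩ := exists_isMulticast (F := F) (B := B) (len := len) G hL f
    (fun t ht => (hf t ht).1) (fun t ht => (hf t ht).2)
  -- The source is excluded explicitly, since feasibility says nothing about `δhat` there.
  set D : Finset V := univ.filter fun v => v ≠ G.source ∧ δhat v = 1 with hD
  have hsD : G.source ∉ D := by simp [hD]
  have hD1 : ∀ v ∈ D, δhat v = 1 := fun v hv => (mem_filter.mp hv).2.2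
  have hD0 : ∀ v, v ≠ G.source → v ∉ D → δhat v = 0 := fun v hv hvD =>
    (hδ v hv).resolve_right fun h => hvD (by simp [hD, hv, h])
  obtain ⟨S, C', hC', himp, hach, hcaching, hgen, hsent, hcache⟩ :=
    exists_scheme C hC D hsD M ε hq
  refine ⟨S, C', hC', himp, hach, fun v hv => ?_, fun i j _ => by rw [hgen],
    fun i j _ => by simp [hsent, hgen], fun r hr _ i j hij => ?_, fun r _ j hj => ?_, le_of_eq ?_⟩
  · rw [hcaching]
    simp [hD, hv]
  · have hj : j ≠ G.source := by rintro rfl; exact G.no_edge_into_source i hij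
    have hr0 : r ≠ 0 := by omega
    rw [hsent, hgen]
    by_cases hjD : j ∈ D
    · simp [hr0, hjD, hD1 j hjD]
    · simp [hjD, hD0 j hj hjD]
  · rw [hcache, hgen]
    by_cases hjD : j ∈ D
    · rw [hD1 j hjD, one_mul]
      split_ifs
      · simp
      · exact le_rfl
    · simp [hjD, hD0 j hj hjD]
  -- The first round gives the first sum of the bound, and the other `N` rounds all cost the same.
  · obtain ⟨N, rfl⟩ : ∃ N, M = N + 1 := ⟨M - 1, by omega⟩
    rw [Scheme.cost, costBound, sum_range_succ', add_comm, hcaching, hgen]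
    congr 1
    · simp [hsent, hℓ]
    · have hround : ∀ r ∈ range N,
          (∑ e ∈ G.edges, linkCost e.1 e.2 (S.sentLen (r + 1) e.1 e.2 * ℓ) +
            if r + 1 = 0 then 0 else ∑ v ∈ D, cacheCost v (S.cacheLen (r + 1) v * ℓ)) =
          roundCostBound G linkCost cacheCost (B * ℓ) (2 * ε * ℓ)
            (fun i j => len i j * ℓ) δhat := by
        intro r _
        rw [← roundCost_eq_roundCostBound linkCost cacheCost _ _ _ δhat D hsD hD1 hD0,
          if_neg (Nat.succ_ne_zero r)]
        congr 1
        · refine sum_congr rfl fun e _ => ?_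
          rw [hsent]
          by_cases he : e.2 ∈ D <;> simp [he]
        · refine sum_congr rfl fun v hv => ?_
          rw [hcache]
          congr 1
          simp only [Nat.succ_ne_zero, hv, not_true, or_self, if_false, outputSize]
          split_ifs
          · rfl
          · push_cast
            rw [sum_mul]
      rw [sum_congr rfl hround, sum_const, card_range, nsmul_eq_mul]
      push_cast
      ring
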